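/- Let $n\ge 2$ and let $X=\{(\sigma(t),t): 1\le t\le n\}$, where $\sigma$ is a permutation of $\{1,\dots,n\}$; the point $(\sigma(t),t)$ means that key $\sigma(t)$ is searched at time $t$. Two points $p,q$ of the plane are satisfied with respect to a set $P$ if they lie on a common horizontal or vertical line, or if the closed axis-parallel rectangle with opposite corners $p,q$ contains a point of $P\setminus\{p,q\}$; $P$ is arborally satisfied if all pairs of its points are. Let $\mathrm{MinArb}(X)$ be the minimum of $|Y|$ over all finite $Y\subset\mathbb R^2$ for which $X\cup Y$ is arborally satisfied. GreedyArb processes the points $p$ of $X$ by increasing $y$-coordinate. If $P$ is the set of all points of $X$ and all added points with smaller $y$-coordinate than $p$, it adds the point $(q.x,p.y)$ for every $q\in P$ such that the pair $(q,p)$ is not satisfied with respect to $P\cup\{p\}$. Let $G(X)$ be the set of all points it adds. In the binary search tree (BST) model, a BST on the keys $1,\dots,n$ serves the requests $\sigma(1),\dots,\sigma(n)$. To serve a request, one replaces a connected part of the tree that contains the root and the requested key by another tree on the same keys, keeping the subtrees that hang from it, and pays the number of nodes of this part. $\mathrm{OPT}(\sigma)$ is the minimum total cost, over all initial trees and all executions.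 GreedyFuture is the offline algorithm that, for each request, touches exactly the search path and rearranges its keys as follows. If the next request is one of these keys, it becomes the root. Otherwise the predecessor and the successor of the next request among these keys become the root and its child, in either order (if only one of the two exists, it becomes the root). The remaining keys on either side are arranged recursively with respect to the future requests on that side, and arbitrarily if there are none. **Theorem.** There are absolute constants $C,c>0$ such that for all $n\ge2$ and all such $X$: 1. $X\cup G(X)$ is arborally satisfied, and $|G(X)|\le C\,n\log n$; 2. $\mathrm{MinArb}(X)\ge c\,n$; 3. $|G(X)|\le C\log n\cdot \mathrm{MinArb}(X)$, i.e. GreedyArb is $O(\log n)$-competitive; 4. from every initial BST on the keys $1,\dots,n$, GreedyFuture has a run on $\sigma(1),\dots,\sigma(n)$, and every such run has total cost at most $C\log n\cdot\mathrm{OPT}(\sigma)$, i.e. GreedyFuture is $O(\log n)$-competitive. -/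

import Mathlib

noncomputable section

namespace GreedyBST

/-! ### The geometric model -/

/-- A pair of points is satisfied with respect to `P` if the two points lie on a common vertical or
horizontal line, or if some third point of `P` lies in the closed axis-parallel rectangle that
they span. -/
def PairSatisfied (P : Set (ℝ × ℝ)) (p q : ℝ × ℝ) : Prop :=
  p.1 = q.1 ∨ p.2 = q.2 ∨
    ∃ r ∈ P, r ≠ p ∧ r ≠ q ∧ r.1 ∈ Set.uIcc p.1 q.1 ∧ r.2 ∈ Set.uIcc p.2 q.2

/-- A point set is arborally satisfied if all pairs of its points are satisfied. -/
def ArborallySatisfied (P : Set (ℝ × ℝ)) : Prop :=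
  ∀ p ∈ P, ∀ q ∈ P, PairSatisfied P p q

/-- `MinArb(X)`: the least number of points whose addition to `X` makes it arborally satisfied.
The added points may lie anywhere in the plane. -/
def minArb (X : Finset (ℝ × ℝ)) : ℕ :=
  sInf {m | ∃ Y : Finset (ℝ × ℝ),
    ArborallySatisfied ((X : Set (ℝ × ℝ)) ∪ (Y : Set (ℝ × ℝ))) ∧ Y.card = m}

open Classical in
/-- The points that `GreedyArb` adds when it processes the point `p`, where `P` is the set of all
points (input and added) with smaller time coordinate: for every unsatisfied rectangle with one
corner `p` and the opposite corner `q ∈ P`, its corner `(q.1, p.2)` on the current line. -/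
def greedyRow (P : Finset (ℝ × ℝ)) (p : ℝ × ℝ) : Finset (ℝ × ℝ) :=
  (P.filter fun q => ¬ PairSatisfied ((insert p P : Finset (ℝ × ℝ)) : Set (ℝ × ℝ)) q p).image
    fun q => (q.1, p.2)

open Classical in
/-- `GreedyArb` on a list of points in order of increasing time. The value is the set of all
points, input and added; each step depends only on the past. -/
def greedyArb (L : List (ℝ × ℝ)) : Finset (ℝ × ℝ) :=
  L.foldl (fun P p => insert p P ∪ greedyRow P p) ∅

/-- The input points in order of time, when `σ t` is the key searched at time `t`. Keys and times
are numbered from `1` to `n`. -/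
def inputList {n : ℕ} (σ : Equiv.Perm (Fin n)) : List (ℝ × ℝ) :=
  List.ofFn fun t : Fin n => (((σ t : ℕ) : ℝ) + 1, ((t : ℕ) : ℝ) + 1)

open Classical in
/-- The permutation input `X`, as a set of points. -/
def inputSet {n : ℕ} (σ : Equiv.Perm (Fin n)) : Finset (ℝ × ℝ) :=
  (inputList σ).toFinset

open Classical in
/-- The set of points that `GreedyArb` adds to the permutation input `X`. -/
def greedyAdded {n : ℕ} (σ : Equiv.Perm (Fin n)) : Finset (ℝ × ℝ) :=
  greedyArb (inputList σ) \ inputSet σ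

/-! ### The binary search tree model -/

/-- The keys of a tree in symmetric order. -/
def inorder {α : Type*} : BinaryTree α → List α
  | .nil => []
  | .node v l r => inorder l ++ v :: inorder r

/-- `graft τ ts` hangs the trees `ts`, from left to right, at the `τ.numNodes + 1` empty places of
`τ`. -/
def graft {α : Type*} : BinaryTree α → List (BinaryTree α) → BinaryTree α
  | .nil, ts => ts.headD .nil
  | .node v l r, ts =>
      .node v (graft l (ts.take (l.numNodes + 1))) (graft r (ts.drop (l.numNodes + 1)))

/-- `T'` arises from `T` by replacing the subtree `τ`, a connected part of `T` that contains the
root, by a tree `τ'` on the same keys; the subtrees hanging from `τ` are kept. -/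
def Reconfigures {α : Type*} (T τ τ' T' : BinaryTree α) : Prop :=
  inorder τ = inorder τ' ∧
    ∃ ts : List (BinaryTree α), ts.length = τ.numNodes + 1 ∧ T = graft τ ts ∧ T' = graft τ' ts

/-- `Executes T S c`: starting from the tree `T`, the request sequence `S` can be served at cost
`c`. To serve a request, one replaces a subtree that contains the root and the requested key, and
pays the number of nodes of this subtree. -/
inductive Executes {α : Type*} : BinaryTree α → List α → ℕ → Prop
  | nil (T : BinaryTree α) : Executes T [] 0
  | cons {T τ τ' T' : BinaryTree α} {x : α} {S : List α} {c : ℕ} :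
      Reconfigures T τ τ' T' → x ∈ inorder τ → Executes T' S c →
      Executes T (x :: S) (τ.numNodes + c)

/-- The search path of the key `x`, from the root down. -/
def searchPath {α : Type*} [LinearOrder α] (x : α) : BinaryTree α → List α
  | .nil => []
  | .node v l r =>
      v :: if x < v then searchPath x l else if v < x then searchPath x r else []

/-- The rule by which `GreedyFuture` arranges the keys of a search path, given the list `F` of
future requests. If the next request is one of the keys, it becomes the root. Otherwise the
predecessor and the successor of the next request among the keys (or the one of them that exists)
become the root and its child: the root is one of the two, and the rule forces the other one to be
its child. The remaining keys on either side are arranged recursively by the same rule, with respect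
to the future requests on that side. Where no request is left, the arrangement is arbitrary. -/
def FutureArranged {α : Type*} [LinearOrder α] : List α → BinaryTree α → Prop
  | _, .nil => True
  | F, .node v l r =>
      (∀ x ∈ F.head?, ∀ k ∈ inorder (.node v l r), k ∈ Set.uIcc v x → k = v) ∧
        FutureArranged (F.filter (· < v)) l ∧ FutureArranged (F.filter (v < ·)) r

/-- `GreedyFutureRun T S c`: a run of `GreedyFuture` from the tree `T` on the request sequence `S`
has cost `c`. Every request is served by touching exactly its search path and rearranging it by
the rule `FutureArranged`. -/
inductive GreedyFutureRun {α : Type*} [LinearOrder α] : BinaryTree α → List α → ℕ → Prop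
  | nil (T : BinaryTree α) : GreedyFutureRun T [] 0
  | cons {T τ τ' T' : BinaryTree α} {x : α} {S : List α} {c : ℕ} :
      Reconfigures T τ τ' T' → (∀ k, k ∈ inorder τ ↔ k ∈ searchPath x T) →
      FutureArranged S τ' → GreedyFutureRun T' S c →
      GreedyFutureRun T (x :: S) (τ.numNodes + c)

/-- `T` is a binary search tree on the keys of `Fin n`. -/
def IsSearchTree {n : ℕ} (T : BinaryTree (Fin n)) : Prop :=
  inorder T = List.finRange n

/-- The request sequence in which `σ t` is the key searched at time `t`. -/
def requests {n : ℕ} (σ : Equiv.Perm (Fin n)) : List (Fin n) :=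
  List.ofFn σ

/-- `OPT`: the least cost of serving the request sequence in the binary search tree model, over
all initial trees and all executions. -/
def optBST {n : ℕ} (σ : Equiv.Perm (Fin n)) : ℕ :=
  sInf {c | ∃ T : BinaryTree (Fin n), IsSearchTree T ∧ Executes T (requests σ) c}

end GreedyBST

end

/-! Both algorithms are governed by one process on keys. Record for each key the time of its last
touch; an access to `x` touches exactly the keys whose time strictly exceeds that of every other key
between them and `x`. For GreedyArb this says that the rectangle spanned with the last point of the
key is empty (`insert_greedyRow`).

For GreedyFuture the touched set must be the search path. The times do not determine the tree, since
all keys of a rearranged path get the same time. But two implications suffice: a strict record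
towards `a` is an ancestor of `a`, and an ancestor `b` of a future request is a strict record
towards the first such request. `FutureArranged` breaks the ties exactly so that both survive each
step (`Consistent.step`), and the next request then sees touched set and search path agree.

The total number of touches is O(n log n) by divide and conquer on the key range. Let `L` be an
interval of keys and take as potential the number of keys of `L` that are strict records of time
from the left or from the right. An access outside `L` touches only such records within `L`, and at
most two of the touched keys remain records. Hence touches across the two halves of an interval are
linear in its length (`touchCount_le_of_disjoint`), and there are about log n levels.

Competitiveness needs only linear lower bounds: input points at consecutive times force an added
point in their strip, and every request costs at least one in a tree. Separately, the greedy output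
is satisfied because each new row repairs all pairs with the past. -/

namespace GreedyBST

/-! ### Touch process and the amortized bound across disjoint key sets -/

section Accesses

variable {α : Type*} [LinearOrder α]

open Classical in
/-- The keys touched by an access to `x`, when `f` records the time of the last touch: the strict
records of `f` on the way from `x` outwards. -/
noncomputable def touched [Fintype α] (f : α → ℕ) (x : α) : Finset α :=
  Finset.univ.filter fun b => ∀ a ∈ Set.uIcc b x, a ≠ b → f a < f b

open Classical in
/-- The last touch times after an access to `x` at time `m`. -/
noncomputable def touch [Fintype α] (f : α → ℕ) (x : α) (m : ℕ) : α → ℕ :=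
  fun b => if b ∈ touched f x then m else f b

open Classical in
/-- The number of touches of keys in `L` by accesses to keys in `R`, when the list is accessed from
time `m` on. -/
noncomputable def touchCount [Fintype α] (R L : Finset α) : (α → ℕ) → ℕ → List α → ℕ
  | _, _, [] => 0
  | f, m, x :: xs =>
      (if x ∈ R then (touched f x ∩ L).card else 0) + touchCount R L (touch f x m) (m + 1) xs

open Classical in
/-- The keys of `L` that are strict records of `f` within `L`, seen from the left or from the
right. -/
noncomputable def records (L : Finset α) (f : α → ℕ) : Finset α :=
  L.filter fun b => (∀ a ∈ L, a < b → f a < f b) ∨ (∀ a ∈ L, b < a → f a < f b)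

variable [Fintype α]

theorem mem_touched {f : α → ℕ} {x b : α} :
    b ∈ touched f x ↔ ∀ a ∈ Set.uIcc b x, a ≠ b → f a < f b := by
  simp [touched]

theorem self_mem_touched (f : α → ℕ) (x : α) : x ∈ touched f x := by
  rw [mem_touched]
  intro a ha hne
  simp at ha
  exact absurd ha hne

theorem touch_lt {f : α → ℕ} {m : ℕ} (hf : ∀ b, f b < m) (x b : α) : touch f x m b < m + 1 := by
  unfold touch
  split_ifs
  · omega
  · have := hf b; omega

theorem touch_of_mem {f : α → ℕ} {x b : α} (m : ℕ) (h : b ∈ touched f x) : touch f x m b = m := by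
  simp [touch, h]

theorem touch_of_not_mem {f : α → ℕ} {x b : α} (m : ℕ) (h : b ∉ touched f x) :
    touch f x m b = f b := by
  simp [touch, h]

omit [Fintype α] in
theorem records_congr {L : Finset α} {f g : α → ℕ} (h : ∀ a ∈ L, f a = g a) :
    records L f = records L g := by
  ext b
  simp only [records, Finset.mem_filter]
  refine and_congr_right fun hb => ?_
  rw [h b hb]
  refine or_congr ?_ ?_ <;>
  · refine forall₂_congr fun a ha => ?_
    rw [h a ha]

open Classical in
-- The touched keys of `L` all share the maximal time `m`, so only the two outermost can be strict
-- records. An untouched record dominates only untouched keys, whose times did not change, so it was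
-- a record before.
theorem records_touch_subset {L : Finset α} {f : α → ℕ} {m : ℕ} (hf : ∀ b, f b < m) {x : α}
    (hS : (touched f x ∩ L).Nonempty) :
    records L (touch f x m) ⊆ (records L f \ (touched f x ∩ L)) ∪
      {(touched f x ∩ L).min' hS, (touched f x ∩ L).max' hS} := by
  set S := touched f x ∩ L with hSdef
  intro b hb
  simp only [records, Finset.mem_filter] at hb
  obtain ⟨hbL, hb⟩ := hb
  have hle : ∀ a, touch f x m a ≤ m := fun a => Nat.lt_succ_iff.mp (touch_lt hf x a)
  have hmem : ∀ s ∈ S, s ∈ L ∧ touch f x m s = m := fun s hs =>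
    ⟨(Finset.mem_inter.mp hs).2, touch_of_mem m (Finset.mem_inter.mp hs).1⟩
  have hmin := S.min'_mem hS
  have hmax := S.max'_mem hS
  simp only [Finset.mem_union, Finset.mem_sdiff, Finset.mem_insert, Finset.mem_singleton]
  by_cases hbS : b ∈ S
  · right
    rcases hb with hb | hb
    · left
      refine le_antisymm ?_ (S.min'_le b hbS)
      by_contra! hlt
      have := hb _ (hmem _ hmin).1 hlt
      rw [(hmem _ hmin).2] at this
      exact absurd (hle b) (by omega)
    · right
      refine le_antisymm (S.le_max' b hbS) ?_
      by_contra! hlt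
      have := hb _ (hmem _ hmax).1 hlt
      rw [(hmem _ hmax).2] at this
      exact absurd (hle b) (by omega)
  · left
    refine ⟨?_, hbS⟩
    have hbt : b ∉ touched f x := fun h => hbS (Finset.mem_inter.mpr ⟨h, hbL⟩)
    have hfb := touch_of_not_mem m hbt
    have key : ∀ a ∈ L, touch f x m a < touch f x m b → f a < f b := by
      intro a _ h
      by_cases hat : a ∈ touched f x
      · rw [touch_of_mem m hat] at h
        exact absurd (hle b) (by omega)
      · rwa [touch_of_not_mem m hat, hfb] at h
    simp only [records, Finset.mem_filter]
    exact ⟨hbL, hb.imp (fun h a ha hab => key a ha (h a ha hab))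
      (fun h a ha hab => key a ha (h a ha hab))⟩

open Classical in
-- As `L` is an interval missing `x`, all keys of `L` on the side of `b` facing `x` lie between `b`
-- and `x`; so `b` is a record seen from that side.
theorem touched_inter_subset_records {L : Finset α} (hL : (L : Set α).OrdConnected) (f : α → ℕ)
    {x : α} (hx : x ∉ L) : touched f x ∩ L ⊆ records L f := by
  intro b hb
  obtain ⟨hbt, hbL⟩ := Finset.mem_inter.mp hb
  rw [mem_touched] at hbt
  simp only [records, Finset.mem_filter]
  refine ⟨hbL, ?_⟩
  rcases lt_or_ge x b with h | h
  · left
    intro a ha hab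
    refine hbt a ?_ hab.ne
    rw [Set.uIcc_of_ge h.le]
    refine ⟨?_, hab.le⟩
    by_contra! hax
    exact hx (hL.out ha hbL ⟨hax.le, h.le⟩)
  · right
    intro a ha hab
    refine hbt a ?_ hab.ne'
    rw [Set.uIcc_of_le h]
    refine ⟨hab.le, ?_⟩
    by_contra! hax
    exact hx (hL.out hbL ha ⟨h, hax.le⟩)

open Classical in
theorem card_records_touch_le {L : Finset α} {f : α → ℕ} {m : ℕ} (hf : ∀ b, f b < m) (x : α) :
    (records L (touch f x m)).card ≤ (records L f).card + 2 := by
  by_cases hS : (touched f x ∩ L).Nonempty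
  · refine (Finset.card_le_card (records_touch_subset hf hS)).trans
      ((Finset.card_union_le _ _).trans ?_)
    exact Nat.add_le_add (Finset.card_le_card Finset.sdiff_subset) Finset.card_le_two
  · have h2 : records L (touch f x m) = records L f := records_congr fun a ha =>
      touch_of_not_mem m fun h => hS ⟨a, Finset.mem_inter.mpr ⟨h, ha⟩⟩
    rw [h2]
    omega

open Classical in
-- Touched keys are paid for by lost records, up to two that survive. The bound `min 2` instead of
-- `2` ensures that the potential does not grow under accesses outside `L`, which matters for those
-- that are not in `R` either and hence count no touches.
theorem card_records_touch_add_le {L : Finset α} (hL : (L : Set α).OrdConnected) {f : α → ℕ}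
    {m : ℕ} (hf : ∀ b, f b < m) {x : α} (hx : x ∉ L) :
    (records L (touch f x m)).card + (touched f x ∩ L).card ≤
      (records L f).card + min 2 (touched f x ∩ L).card := by
  by_cases hS : (touched f x ∩ L).Nonempty
  · have h1 := (Finset.card_le_card (records_touch_subset (L := L) hf hS)).trans
      (Finset.card_union_le _ _)
    have h2 := Finset.card_sdiff_add_card_eq_card (touched_inter_subset_records hL f hx)
    have h3 : ({(touched f x ∩ L).min' hS, (touched f x ∩ L).max' hS} : Finset α).card ≤ 2 :=
      Finset.card_le_two
    have h4 : ({(touched f x ∩ L).min' hS, (touched f x ∩ L).max' hS} : Finset α).card ≤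
        (touched f x ∩ L).card := by
      refine Finset.card_le_card ?_
      intro a ha
      simp only [Finset.mem_insert, Finset.mem_singleton] at ha
      rcases ha with rfl | rfl
      · exact Finset.min'_mem _ _
      · exact Finset.max'_mem _ _
    omega
  · have h2 : records L (touch f x m) = records L f := records_congr fun a ha =>
      touch_of_not_mem m fun h => hS ⟨a, Finset.mem_inter.mpr ⟨h, ha⟩⟩
    rw [Finset.not_nonempty_iff_eq_empty.mp hS, h2]
    simp

open Classical in
theorem touchCount_le_records {R L : Finset α} (hRL : Disjoint R L)
    (hL : (L : Set α).OrdConnected) (xs : List α) (f : α → ℕ) (m : ℕ) (hf : ∀ b, f b < m) :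
    touchCount R L f m xs ≤
      2 * xs.countP (· ∈ R) + 2 * xs.countP (· ∈ L) + (records L f).card := by
  induction xs generalizing f m with
  | nil => simp [touchCount]
  | cons x xs ih =>
    have h := ih (touch f x m) (m + 1) (touch_lt hf x)
    simp only [touchCount, List.countP_cons, decide_eq_true_eq]
    by_cases hxL : x ∈ L
    · have hxR : x ∉ R := fun h => Finset.disjoint_left.mp hRL h hxL
      have := card_records_touch_le (L := L) hf x
      simp only [hxL, hxR, if_true, if_false]
      omega
    · have := card_records_touch_add_le hL hf hxL
      by_cases hxR : x ∈ R
      · simp only [hxL, hxR, if_true, if_false]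
        omega
      · simp only [hxL, hxR, if_false]
        omega

omit [Fintype α] in
open Classical in
theorem countP_mem_le_card {xs : List α} (hxs : xs.Nodup) (R : Finset α) :
    xs.countP (· ∈ R) ≤ R.card := by
  rw [List.countP_eq_length_filter, ← List.toFinset_card_of_nodup (hxs.filter _)]
  refine Finset.card_le_card fun a ha => ?_
  simpa using (List.mem_filter.mp (List.mem_toFinset.mp ha)).2

theorem touchCount_le_of_disjoint {R L : Finset α} (hRL : Disjoint R L)
    (hL : (L : Set α).OrdConnected) {xs : List α} (hxs : xs.Nodup) {f : α → ℕ} {m : ℕ}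
    (hf : ∀ b, f b < m) :
    touchCount R L f m xs ≤ 2 * R.card + 3 * L.card := by
  classical
  have h1 := touchCount_le_records hRL hL xs f m hf
  have h2 := countP_mem_le_card hxs R
  have h3 := countP_mem_le_card hxs L
  -- The initial potential supplies the third unit per key of `L`.
  have h4 : (records L f).card ≤ L.card :=
    Finset.card_le_card fun b hb => by
      simp only [records, Finset.mem_filter] at hb
      exact hb.1
  omega

/-- This crude bound serves as the base case, for intervals with at most one key. -/
theorem touchCount_le_mul {R L : Finset α} {xs : List α} (hxs : xs.Nodup) (f : α → ℕ) (m : ℕ) :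
    touchCount R L f m xs ≤ R.card * L.card := by
  classical
  refine le_trans ?_ (Nat.mul_le_mul_right _ (countP_mem_le_card hxs R))
  clear hxs
  induction xs generalizing f m with
  | nil => simp [touchCount]
  | cons x xs ih =>
    have h := ih (touch f x m) (m + 1)
    have h2 : (touched f x ∩ L).card ≤ L.card := Finset.card_le_card Finset.inter_subset_right
    simp only [touchCount, List.countP_cons, decide_eq_true_eq]
    split_ifs
    · rw [add_mul]; omega
    · simpa using h

open Classical in
theorem touchCount_union_le (A B : Finset α) (xs : List α) (f : α → ℕ) (m : ℕ) :
    touchCount (A ∪ B) (A ∪ B) f m xs ≤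
      touchCount A A f m xs + touchCount B B f m xs + touchCount A B f m xs +
        touchCount B A f m xs := by
  induction xs generalizing f m with
  | nil => simp [touchCount]
  | cons x xs ih =>
    have h := ih (touch f x m) (m + 1)
    have h2 : (touched f x ∩ (A ∪ B)).card ≤ (touched f x ∩ A).card + (touched f x ∩ B).card := by
      rw [Finset.inter_union_distrib_left]
      exact Finset.card_union_le _ _
    simp only [touchCount, Finset.mem_union]
    by_cases hA : x ∈ A <;> by_cases hB : x ∈ B <;> simp only [hA, hB, if_true, if_false, or_true,
      or_false] <;> omega

end Accesses

/-! ### Divide and conquer over intervals of keys -/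

/-- The keys of `Fin n` in the half-open interval from `a` to `b`. -/
def finIco (n a b : ℕ) : Finset (Fin n) :=
  Finset.univ.filter fun k => a ≤ k.val ∧ k.val < b

theorem card_finIco_le (n a b : ℕ) : (finIco n a b).card ≤ b - a := by
  rw [← Nat.card_Ico, ← Finset.card_map Fin.valEmbedding]
  refine Finset.card_le_card fun k hk => ?_
  simp only [finIco, Finset.mem_map, Finset.mem_filter, Finset.mem_univ, true_and] at hk
  obtain ⟨i, hi, rfl⟩ := hk
  simpa using hi

theorem ordConnected_finIco (n a b : ℕ) : (finIco n a b : Set (Fin n)).OrdConnected := by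
  refine ⟨fun x hx y hy z hz => ?_⟩
  simp only [finIco, Finset.coe_filter, Finset.mem_univ, true_and, Set.mem_ofPred_eq] at hx hy ⊢
  have h1 : x.val ≤ z.val := hz.1
  have h2 : z.val ≤ y.val := hz.2
  omega

/-- Each of the `d` levels of halving charges a key `2` for its own accesses across the cut and `3`
for touches from the other side, whence the `5`. -/
theorem touchCount_finIco_le {n : ℕ} {xs : List (Fin n)} (hxs : xs.Nodup) {f : Fin n → ℕ} {m : ℕ}
    (hf : ∀ b, f b < m) (d a b : ℕ) (hab : b - a ≤ 2 ^ d) :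
    touchCount (finIco n a b) (finIco n a b) f m xs ≤ (b - a) * (5 * d + 1) := by
  induction d generalizing a b with
  | zero =>
    have h1 := touchCount_le_mul (R := finIco n a b) (L := finIco n a b) hxs f m
    have h2 := card_finIco_le n a b
    have h3 := Nat.mul_le_mul h2 h2
    have h4 : (b - a) * (b - a) ≤ (b - a) * 1 := Nat.mul_le_mul_left _ (by simpa using hab)
    simp only [mul_zero, zero_add]
    omega
  | succ d ih =>
    classical
    have hp : 2 ^ (d + 1) = 2 * 2 ^ d := by ring
    generalize 2 ^ d = p at ih hp
    obtain ⟨c, h1, h2, h3, h4⟩ : ∃ c, c - a ≤ p ∧ b - c ≤ p ∧ c - a + (b - c) = b - a ∧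
        a ≤ c ∧ (c ≤ b ∨ c = a) := by
      -- The cut is clamped so that it also works when `b < a`, where `b - a` truncates to zero.
      refine ⟨max a (min b (a + p)), ?_, ?_, ?_, ?_, ?_⟩ <;> omega
    have hU : finIco n a b = finIco n a c ∪ finIco n c b := by
      ext k
      simp only [finIco, Finset.mem_union, Finset.mem_filter, Finset.mem_univ, true_and]
      omega
    have hD : Disjoint (finIco n a c) (finIco n c b) := by
      rw [Finset.disjoint_left]
      intro k
      simp only [finIco, Finset.mem_filter, Finset.mem_univ, true_and]
      omega
    rw [hU]
    refine (touchCount_union_le _ _ _ _ _).trans ?_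
    have t1 := ih a c h1
    have t2 := ih c b h2
    have t3 := touchCount_le_of_disjoint hD (ordConnected_finIco n c b) hxs hf
    have t4 := touchCount_le_of_disjoint hD.symm (ordConnected_finIco n a c) hxs hf
    have c1 := card_finIco_le n a c
    have c2 := card_finIco_le n c b
    have e : (b - a) * (5 * (d + 1) + 1) =
        (c - a) * (5 * d + 1) + (b - c) * (5 * d + 1) + 5 * (c - a) + 5 * (b - c) := by
      rw [← h3]; ring
    omega

/-- Accessing distinct keys of `Fin n` touches `O(n log n)` keys. -/
theorem touchCount_univ_le {n : ℕ} {xs : List (Fin n)} (hxs : xs.Nodup) {f : Fin n → ℕ} {m : ℕ}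
    (hf : ∀ b, f b < m) :
    touchCount Finset.univ Finset.univ f m xs ≤ n * (5 * Nat.clog 2 n + 1) := by
  have h := touchCount_finIco_le hxs hf (Nat.clog 2 n) 0 n
    (by simpa using Nat.le_pow_clog one_lt_two n)
  have h2 : finIco n 0 n = Finset.univ := by
    ext k; simp [finIco]
  simpa [h2] using h

end GreedyBST
namespace GreedyBST

/-! ### The geometric greedy algorithm -/

theorem PairSatisfied.mono {P Q : Set (ℝ × ℝ)} (h : P ⊆ Q) {p q : ℝ × ℝ}
    (hp : PairSatisfied P p q) : PairSatisfied Q p q := by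
  rcases hp with hp | hp | ⟨r, hr, h1⟩
  · exact Or.inl hp
  · exact Or.inr (Or.inl hp)
  · exact Or.inr (Or.inr ⟨r, h hr, h1⟩)

theorem PairSatisfied.symm {P : Set (ℝ × ℝ)} {p q : ℝ × ℝ} (hp : PairSatisfied P p q) :
    PairSatisfied P q p := by
  rcases hp with hp | hp | ⟨r, hr, h1, h2, h3, h4⟩
  · exact Or.inl hp.symm
  · exact Or.inr (Or.inl hp.symm)
  · exact Or.inr (Or.inr ⟨r, hr, h2, h1, Set.uIcc_comm p.1 q.1 ▸ h3, Set.uIcc_comm p.2 q.2 ▸ h4⟩)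

open Classical in
-- If `q` is not later than `q'`, then `q'` itself is a witness, unless the columns agree. Otherwise
-- `p` is a witness when its column lies between. In the remaining case either `q` also gets a
-- corner on the row, or some `w` satisfies `q` and `p`; this `w` is a witness, since otherwise it
-- would lie in the empty rectangle of `q'` and `p`.
theorem pairSatisfied_greedyRow {P : Finset (ℝ × ℝ)} {p : ℝ × ℝ} (hP : ∀ q ∈ P, q.2 < p.2)
    {q q' : ℝ × ℝ} (hq : q ∈ P) (hq' : q' ∈ P)
    (hun : ¬ PairSatisfied ((insert p P : Finset (ℝ × ℝ)) : Set (ℝ × ℝ)) q' p) :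
    PairSatisfied ((insert p P ∪ greedyRow P p : Finset (ℝ × ℝ)) : Set (ℝ × ℝ)) q
      (q'.1, p.2) := by
  have hqp := hP q hq
  have hqp' := hP q' hq'
  by_cases h1 : q.1 = q'.1
  · exact Or.inl h1
  right; right
  by_cases h2 : q.2 ≤ q'.2
  · refine ⟨q', by simp [hq'], fun h => h1 (by rw [h]), fun h => ?_, Set.right_mem_uIcc, ?_⟩
    · have := congrArg Prod.snd h
      exact hqp'.ne this
    · exact Set.mem_uIcc_of_le h2 hqp'.le
  push Not at h2
  unfold PairSatisfied at hun
  push Not at hun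
  obtain ⟨hx, -, hempty⟩ := hun
  by_cases h3 : p.1 ∈ Set.uIcc q.1 q'.1
  · refine ⟨p, by simp, fun h => hqp.ne (by rw [h]), fun h => hx ?_, h3, Set.right_mem_uIcc⟩
    rw [h]
  by_cases h4 : PairSatisfied ((insert p P : Finset (ℝ × ℝ)) : Set (ℝ × ℝ)) q p
  · rcases h4 with h | h | ⟨w, hw, hwq, hwp, hw1, hw2⟩
    · rw [← h] at h3
      exact absurd Set.left_mem_uIcc h3
    · exact absurd h hqp.ne
    · have hwP : w ∈ P := by simpa [hwp] using hw
      have hwy := hP w hwP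
      by_cases h5 : w.1 ∈ Set.uIcc q.1 q'.1
      · exact ⟨w, by simp [hwP], hwq, fun h => hwy.ne (by rw [h]), h5, hw2⟩
      · exfalso
        rw [Set.mem_uIcc] at h3 h5 hw1 hw2
        have hwy2 : q.2 ≤ w.2 := by
          rcases hw2 with h | h
          · exact h.1
          · linarith
        refine hempty w hw (fun h => ?_) hwp ?_ ?_
        · rw [h] at hwy2; linarith
        · rw [Set.mem_uIcc]
          push Not at h3 h5
          rcases hw1 with h | h
          · rcases le_total q.1 q'.1 with h6 | h6
            · have := h5.1 h.1
              left; constructor <;> linarith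
            · left; constructor <;> linarith
          · rcases le_total q.1 q'.1 with h6 | h6
            · right; constructor <;> linarith
            · right
              refine ⟨h.1, ?_⟩
              by_contra! h7
              exact absurd (h5.2 h7.le) (by linarith)
        · exact Set.mem_uIcc_of_le (by linarith) hwy.le
  · refine ⟨(q.1, p.2), ?_, fun h => hqp.ne' ?_, fun h => h1 ?_,
      Set.left_mem_uIcc, Set.right_mem_uIcc⟩
    · simp only [Finset.coe_union, Set.mem_union, Finset.mem_coe]
      right
      exact Finset.mem_image.mpr ⟨q, Finset.mem_filter.mpr ⟨hq, h4⟩, rfl⟩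
    · simpa using congrArg Prod.snd h
    · simpa using congrArg Prod.fst h

open Classical in
theorem snd_eq_of_mem_greedyRow {P : Finset (ℝ × ℝ)} {p r : ℝ × ℝ} (h : r ∈ greedyRow P p) :
    r.2 = p.2 := by
  obtain ⟨q, -, rfl⟩ := Finset.mem_image.mp h
  rfl

open Classical in
theorem arborallySatisfied_greedy_step {P : Finset (ℝ × ℝ)} {p : ℝ × ℝ}
    (hP : ∀ q ∈ P, q.2 < p.2) (hsat : ArborallySatisfied (P : Set (ℝ × ℝ))) :
    ArborallySatisfied ((insert p P ∪ greedyRow P p : Finset (ℝ × ℝ)) : Set (ℝ × ℝ)) := by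
  have hrow : ∀ r ∈ insert p P ∪ greedyRow P p, r ∈ P ∨ r.2 = p.2 := by
    intro r hr
    simp only [Finset.mem_union, Finset.mem_insert] at hr
    rcases hr with (rfl | hr) | hr
    · exact Or.inr rfl
    · exact Or.inl hr
    · exact Or.inr (snd_eq_of_mem_greedyRow hr)
  have hmix : ∀ q ∈ P, ∀ r ∈ insert p P ∪ greedyRow P p, r.2 = p.2 →
      PairSatisfied ((insert p P ∪ greedyRow P p : Finset (ℝ × ℝ)) : Set (ℝ × ℝ)) q r := by
    intro q hq r hr hrp
    simp only [Finset.mem_union, Finset.mem_insert] at hr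
    rcases hr with (rfl | hr) | hr
    · by_cases h : PairSatisfied ((insert r P : Finset (ℝ × ℝ)) : Set (ℝ × ℝ)) q r
      · refine h.mono ?_
        intro a ha
        simp only [Finset.coe_union, Set.mem_union]
        exact Or.inl ha
      · refine Or.inr (Or.inr ⟨(q.1, r.2), ?_, fun h2 => (hP q hq).ne' ?_, fun h1 => h (Or.inl ?_),
          Set.left_mem_uIcc, Set.right_mem_uIcc⟩)
        · simp only [Finset.coe_union, Set.mem_union, Finset.mem_coe]
          right
          exact Finset.mem_image.mpr ⟨q, Finset.mem_filter.mpr ⟨hq, h⟩, rfl⟩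
        · simpa using congrArg Prod.snd h2
        · simpa using congrArg Prod.fst h1
    · exact absurd hrp (hP r hr).ne
    · obtain ⟨q', hq', rfl⟩ := Finset.mem_image.mp hr
      obtain ⟨hq', hun⟩ := Finset.mem_filter.mp hq'
      exact pairSatisfied_greedyRow hP hq hq' hun
  intro a ha b hb
  rcases hrow a ha with haP | hap
  · rcases hrow b hb with hbP | hbp
    · refine (hsat a haP b hbP).mono ?_
      intro c hc
      simp only [Finset.coe_union, Set.mem_union]
      left
      simpa using Or.inr hc
    · exact hmix a haP b hb hbp
  · rcases hrow b hb with hbP | hbp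
    · exact (hmix b hbP a ha hap).symm
    · exact Or.inr (Or.inl (hap.trans hbp.symm))

open Classical in
theorem arborallySatisfied_foldl (L : List (ℝ × ℝ)) (hL : L.Pairwise fun p q => p.2 < q.2)
    (P : Finset (ℝ × ℝ)) (hP : ∀ q ∈ P, ∀ p ∈ L, q.2 < p.2)
    (hsat : ArborallySatisfied (P : Set (ℝ × ℝ))) :
    ArborallySatisfied
      ((L.foldl (fun P p => insert p P ∪ greedyRow P p) P : Finset (ℝ × ℝ)) : Set (ℝ × ℝ)) := by
  induction L generalizing P with
  | nil => exact hsat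
  | cons p L ih =>
    rw [List.pairwise_cons] at hL
    refine ih hL.2 _ ?_ (arborallySatisfied_greedy_step (fun q hq => hP q hq p (by simp)) hsat)
    intro q hq r hr
    simp only [Finset.mem_union, Finset.mem_insert] at hq
    rcases hq with (rfl | hq) | hq
    · exact hL.1 r hr
    · exact hP q hq r (List.mem_cons_of_mem _ hr)
    · rw [snd_eq_of_mem_greedyRow hq]
      exact hL.1 r hr

/-- The output of `GreedyArb` is arborally satisfied. -/
theorem arborallySatisfied_greedyArb {L : List (ℝ × ℝ)} (hL : L.Pairwise fun p q => p.2 < q.2) :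
    ArborallySatisfied (greedyArb L : Set (ℝ × ℝ)) :=
  arborallySatisfied_foldl L hL ∅ (by simp) (by simp [ArborallySatisfied])

open Classical in
theorem subset_foldl_greedy (L : List (ℝ × ℝ)) (P : Finset (ℝ × ℝ)) :
    P ∪ L.toFinset ⊆ L.foldl (fun P p => insert p P ∪ greedyRow P p) P := by
  induction L generalizing P with
  | nil => simp
  | cons p L ih =>
    refine Finset.Subset.trans ?_ (ih _)
    intro a ha
    simp only [List.toFinset_cons, Finset.mem_union, Finset.mem_insert] at ha ⊢
    tauto

theorem pairwise_inputList {n : ℕ} (σ : Equiv.Perm (Fin n)) :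
    (inputList σ).Pairwise fun p q => p.2 < q.2 := by
  unfold inputList
  rw [List.pairwise_ofFn]
  intro i j hij
  have : (i : ℕ) < (j : ℕ) := hij
  simpa using this

theorem coe_inputSet_union_greedyAdded {n : ℕ} (σ : Equiv.Perm (Fin n)) :
    (inputSet σ : Set (ℝ × ℝ)) ∪ (greedyAdded σ : Set (ℝ × ℝ)) = greedyArb (inputList σ) := by
  classical
  have h : inputSet σ ⊆ greedyArb (inputList σ) := by
    refine Finset.Subset.trans ?_ (subset_foldl_greedy (inputList σ) ∅)
    intro a ha
    simp only [inputSet, List.mem_toFinset, Finset.empty_union] at ha ⊢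
    exact ha
  ext a
  simp only [greedyAdded, Set.mem_union, Finset.mem_coe, Finset.mem_sdiff]
  constructor
  · rintro (ha | ha)
    · exact h ha
    · exact ha.1
  · intro ha
    by_cases hx : a ∈ inputSet σ
    · exact Or.inl hx
    · exact Or.inr ⟨ha, hx⟩

/-! ### Counting the points of the greedy algorithm -/

/-- The point of the plane for the key `k` (numbered from zero) and the time `s`. -/
def gridPoint {n : ℕ} (k : Fin n) (s : ℕ) : ℝ × ℝ := ((k : ℕ) + 1, s)

theorem gridPoint_inj {n : ℕ} {k l : Fin n} {s t : ℕ} :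
    gridPoint k s = gridPoint l t ↔ k = l ∧ s = t := by
  simp [gridPoint, Prod.ext_iff, Fin.ext_iff]

theorem gridPoint_mem_uIcc {n : ℕ} {a b c : Fin n} {s t u : ℕ} :
    ((gridPoint a s).1 ∈ Set.uIcc (gridPoint b t).1 (gridPoint c u).1 ↔ a ∈ Set.uIcc b c) ∧
    ((gridPoint a s).2 ∈ Set.uIcc (gridPoint b t).2 (gridPoint c u).2 ↔ s ∈ Set.uIcc t u) := by
  simp [gridPoint, Set.mem_uIcc]

/-- The points `P` record the touch times of keys, the last of which are given by `f`. -/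
structure Records {n : ℕ} (P : Finset (ℝ × ℝ)) (f : Fin n → ℕ) : Prop where
  exists_eq : ∀ q ∈ P, ∃ k s, q = gridPoint k s ∧ 0 < s ∧ s ≤ f k
  last_mem : ∀ k, 0 < f k → gridPoint k (f k) ∈ P

open Classical in
theorem insert_greedyRow {n : ℕ} {P : Finset (ℝ × ℝ)} {f : Fin n → ℕ} (h : Records P f) {m : ℕ}
    (hf : ∀ k, f k < m) (x : Fin n) :
    insert (gridPoint x m) (greedyRow P (gridPoint x m)) =
      (touched f x).image fun k => gridPoint k m := by
  ext r
  simp only [Finset.mem_insert, Finset.mem_image, greedyRow, Finset.mem_filter]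
  constructor
  · rintro (rfl | ⟨q, ⟨hq, hun⟩, rfl⟩)
    · exact ⟨x, self_mem_touched f x, rfl⟩
    · obtain ⟨k, s, rfl, hs, hsf⟩ := h.exists_eq q hq
      refine ⟨k, mem_touched.mpr fun a ha hak => ?_, rfl⟩
      by_contra! hfa
      -- Real times are positive and `0` means never touched; from `f a ≥ f k ≥ s > 0`, the key `a`
      -- has a last point, and it lies in the rectangle.
      refine hun (Or.inr (Or.inr ⟨gridPoint a (f a), ?_, ?_, ?_, ?_, ?_⟩))
      · have := h.last_mem a (by omega)
        simp [this]
      · exact fun h => hak (gridPoint_inj.mp h).1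
      · exact fun h => (hf a).ne (gridPoint_inj.mp h).2
      · exact gridPoint_mem_uIcc.1.mpr ha
      · exact gridPoint_mem_uIcc.2.mpr (Set.mem_uIcc_of_le (by omega) (hf a).le)
  · rintro ⟨k, hk, rfl⟩
    rw [mem_touched] at hk
    by_cases hkx : k = x
    · left; rw [hkx]
    right
    have hlt := hk x Set.right_mem_uIcc (Ne.symm hkx)
    -- Among the points in the column of `k`, the last one spans the smallest rectangle.
    refine ⟨gridPoint k (f k), ⟨h.last_mem k (by omega), ?_⟩, rfl⟩
    rintro (h1 | h1 | ⟨w, hw, hwk, hwx, hw1, hw2⟩)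
    · simp only [gridPoint, add_left_inj, Nat.cast_inj] at h1
      exact hkx (Fin.ext h1)
    · simp only [gridPoint, Nat.cast_inj] at h1
      exact (hf k).ne h1
    · have hwP : w ∈ P := by simpa [hwx] using hw
      obtain ⟨a, s, rfl, hs, hsf⟩ := h.exists_eq w hwP
      rw [gridPoint_mem_uIcc.1] at hw1
      rw [gridPoint_mem_uIcc.2, Set.uIcc_of_le (hf k).le] at hw2
      have h3 := hw2.1
      by_cases hak : a = k
      · subst hak
        exact hwk (gridPoint_inj.mpr ⟨rfl, by omega⟩)
      · have := hk a hw1 hak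
        omega

/-- The points for accesses to the keys of a list from time `m` on. -/
def timed {n : ℕ} : ℕ → List (Fin n) → List (ℝ × ℝ)
  | _, [] => []
  | m, x :: xs => gridPoint x m :: timed (m + 1) xs

theorem ofFn_gridPoint {n k : ℕ} (g : Fin k → Fin n) (m : ℕ) :
    List.ofFn (fun t : Fin k => gridPoint (g t) (t + m)) = timed m (List.ofFn g) := by
  induction k generalizing m with
  | zero => simp [timed]
  | succ k ih =>
    rw [List.ofFn_succ, List.ofFn_succ, timed, ← ih]
    simp [add_comm, add_left_comm]

theorem inputList_eq_timed {n : ℕ} (σ : Equiv.Perm (Fin n)) :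
    inputList σ = timed 1 (requests σ) := by
  unfold requests
  rw [← ofFn_gridPoint]
  simp [inputList, gridPoint]

open Classical in
theorem card_foldl_greedy_le {n : ℕ} (xs : List (Fin n)) {P : Finset (ℝ × ℝ)} {f : Fin n → ℕ}
    (h : Records P f) {m : ℕ} (hm : 0 < m) (hf : ∀ k, f k < m) :
    ((timed m xs).foldl (fun P p => insert p P ∪ greedyRow P p) P).card ≤
      P.card + touchCount Finset.univ Finset.univ f m xs := by
  induction xs generalizing P f m with
  | nil => simp [timed]
  | cons x xs ih =>
    have hrow := insert_greedyRow h hf x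
    have hP : insert (gridPoint x m) P ∪ greedyRow P (gridPoint x m) =
        P ∪ (touched f x).image fun k => gridPoint k m := by
      rw [← hrow]
      ext a
      simp only [Finset.mem_union, Finset.mem_insert]
      tauto
    have h' : Records (P ∪ (touched f x).image fun k => gridPoint k m) (touch f x m) := by
      constructor
      · intro q hq
        rcases Finset.mem_union.mp hq with hq | hq
        · obtain ⟨k, s, rfl, hs, hsf⟩ := h.exists_eq q hq
          refine ⟨k, s, rfl, hs, ?_⟩
          have := hf k
          unfold touch
          split_ifs <;> omega
        · obtain ⟨k, hk, rfl⟩ := Finset.mem_image.mp hq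
          exact ⟨k, m, rfl, hm, (touch_of_mem m hk).ge⟩
      · intro k hk
        by_cases hkt : k ∈ touched f x
        · rw [touch_of_mem m hkt]
          exact Finset.mem_union_right _ (Finset.mem_image_of_mem _ hkt)
        · rw [touch_of_not_mem m hkt] at hk ⊢
          exact Finset.mem_union_left _ (h.last_mem k hk)
    have := ih h' (m := m + 1) (Nat.succ_pos m) (touch_lt hf x)
    simp only [timed, List.foldl_cons, touchCount, Finset.mem_univ, if_true, Finset.inter_univ]
    rw [hP]
    have h2 := Finset.card_union_le P ((touched f x).image fun k => gridPoint k m)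
    have h3 : ((touched f x).image fun k => gridPoint k m).card ≤ (touched f x).card :=
      Finset.card_image_le
    omega

theorem nodup_requests {n : ℕ} (σ : Equiv.Perm (Fin n)) : (requests σ).Nodup :=
  List.nodup_ofFn.mpr σ.injective

theorem card_greedyAdded_le {n : ℕ} (σ : Equiv.Perm (Fin n)) :
    (greedyAdded σ).card ≤ n * (5 * Nat.clog 2 n + 1) := by
  classical
  have h1 : (greedyAdded σ).card ≤ (greedyArb (inputList σ)).card :=
    Finset.card_le_card fun a ha => by
      simp only [greedyAdded, Finset.mem_sdiff] at ha
      exact ha.1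
  have h2 := card_foldl_greedy_le (requests σ) (P := ∅) (f := fun _ => 0)
    ⟨by simp, by simp⟩ one_pos (fun _ => one_pos)
  have h3 := touchCount_univ_le (nodup_requests σ) (f := fun _ => 0) (m := 1) (fun _ => one_pos)
  rw [inputList_eq_timed] at h1
  simp only [Finset.card_empty, zero_add] at h2
  exact h1.trans (h2.trans h3)

/-! ### The lower bound for satisfied supersets -/

/-- Pair up the times as `2j+1, 2j+2`. The two input points differ in both coordinates, and the
closed strip between their rows contains no other input point, so the witness is in `Y`. The strips
are disjoint. -/
theorem half_le_card_of_arborallySatisfied {n : ℕ} (σ : Equiv.Perm (Fin n))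
    {Y : Finset (ℝ × ℝ)}
    (hY : ArborallySatisfied ((inputSet σ : Set (ℝ × ℝ)) ∪ (Y : Set (ℝ × ℝ)))) :
    n / 2 ≤ Y.card := by
  classical
  have hmem : ∀ r, r ∈ inputSet σ ↔
      ∃ u : Fin n, (((σ u : ℕ) : ℝ) + 1, ((u : ℕ) : ℝ) + 1) = r := by
    intro r
    simp [inputSet, inputList, List.mem_ofFn]
  have key : ∀ j : ℕ, j < n / 2 → ∃ r ∈ Y, (2 * j + 1 : ℝ) ≤ r.2 ∧ r.2 ≤ 2 * j + 2 := by
    intro j hj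
    let t : Fin n := ⟨2 * j, by omega⟩
    let t' : Fin n := ⟨2 * j + 1, by omega⟩
    have htt : t ≠ t' := by simp [t, t']
    rcases hY _ (Or.inl ((hmem _).mpr ⟨t, rfl⟩)) _ (Or.inl ((hmem _).mpr ⟨t', rfl⟩)) with
      h | h | ⟨r, hr, hrp, hrq, -, hr2⟩
    · simp only [add_left_inj, Nat.cast_inj] at h
      exact absurd (σ.injective (Fin.ext h)) htt
    · simp only [add_left_inj, Nat.cast_inj] at h
      exact absurd (Fin.ext h) htt
    · have hr3 : (2 * j + 1 : ℝ) ≤ r.2 ∧ r.2 ≤ 2 * j + 2 := by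
        rw [Set.uIcc_of_le (by simp [t, t'])] at hr2
        simp only [t, t', Set.mem_Icc] at hr2
        push_cast at hr2
        constructor <;> linarith [hr2.1, hr2.2]
      rcases hr with hr | hr
      · exfalso
        obtain ⟨u, rfl⟩ := (hmem _).mp hr
        simp only at hr3
        have h1 : 2 * j ≤ (u : ℕ) := by
          have : (2 * j : ℝ) ≤ (u : ℕ) := by linarith [hr3.1]
          exact_mod_cast this
        have h2 : (u : ℕ) ≤ 2 * j + 1 := by
          have : ((u : ℕ) : ℝ) ≤ 2 * j + 1 := by linarith [hr3.2]
          exact_mod_cast this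
        rcases (by omega : (u : ℕ) = 2 * j ∨ (u : ℕ) = 2 * j + 1) with h | h
        · exact hrp (by rw [show u = t from Fin.ext h])
        · exact hrq (by rw [show u = t' from Fin.ext h])
      · exact ⟨r, hr, hr3⟩
  choose g hgY hg1 hg2 using key
  have hinj : Function.Injective fun j : Fin (n / 2) => (⟨g j j.2, hgY j j.2⟩ : Y) := by
    intro i j hij
    have h : g i i.2 = g j j.2 := congrArg Subtype.val hij
    have h1 := hg1 i i.2
    have h2 := hg2 i i.2
    have h3 := hg1 j j.2
    have h4 := hg2 j j.2
    rw [h] at h1 h2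
    have h5 : ((i : ℕ) : ℝ) < (j : ℕ) + 1 := by linarith
    have h6 : ((j : ℕ) : ℝ) < (i : ℕ) + 1 := by linarith
    have h7 : (i : ℕ) < (j : ℕ) + 1 := by exact_mod_cast h5
    have h8 : (j : ℕ) < (i : ℕ) + 1 := by exact_mod_cast h6
    exact Fin.ext (by omega)
  simpa using Fintype.card_le_of_injective _ hinj

theorem half_le_minArb {n : ℕ} (σ : Equiv.Perm (Fin n)) : n / 2 ≤ minArb (inputSet σ) := by
  -- The greedy output shows that the infimum is over a nonempty set; over the empty set it would be
  -- `0`.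
  refine le_csInf ⟨_, greedyAdded σ, ?_, rfl⟩ ?_
  · rw [coe_inputSet_union_greedyAdded]
    exact arborallySatisfied_greedyArb (pairwise_inputList σ)
  · rintro m ⟨Y, hY, rfl⟩
    exact half_le_card_of_arborallySatisfied σ hY

end GreedyBST
namespace GreedyBST

/-! ### Search trees -/

section Tree

variable {α : Type*}

theorem length_inorder (T : BinaryTree α) : (inorder T).length = T.numNodes := by
  induction T with
  | nil => rfl
  | node v l r hl hr => simp [inorder, hl, hr]; omega

/-- The keys of the trees `ts` with the keys `K` placed between them. -/
def weave : List α → List (BinaryTree α) → List α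
  | [], ts => inorder (ts.headD .nil)
  | k :: K, ts => inorder (ts.headD .nil) ++ k :: weave K ts.tail

theorem weave_append (K : List α) (v : α) (K' : List α) (ts : List (BinaryTree α)) :
    weave (K ++ v :: K') ts =
      weave K (ts.take (K.length + 1)) ++ v :: weave K' (ts.drop (K.length + 1)) := by
  induction K generalizing ts with
  | nil => cases ts <;> simp [weave]
  | cons k K ih => cases ts <;> simp [weave, ih]

theorem inorder_graft (τ : BinaryTree α) (ts : List (BinaryTree α)) :
    inorder (graft τ ts) = weave (inorder τ) ts := by
  induction τ generalizing ts with
  | nil => rfl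
  | node v l r hl hr => rw [graft, inorder, inorder, weave_append, hl, hr, length_inorder]

theorem sublist_weave (K : List α) (ts : List (BinaryTree α)) : K.Sublist (weave K ts) := by
  induction K generalizing ts with
  | nil => simp
  | cons k K ih => exact ((ih ts.tail).cons_cons k).trans (List.sublist_append_right _ _)

/-- Forgetting the order suffices to see that in a tree without repeated keys the hanging trees
avoid the keys of the replaced part. -/
theorem weave_perm (K : List α) (ts : List (BinaryTree α)) (h : ts.length = K.length + 1) :
    (weave K ts).Perm (K ++ (ts.map inorder).flatten) := by
  induction K generalizing ts with
  | nil =>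
    match ts, h with
    | [t], _ => simp [weave]
  | cons k K ih =>
    match ts, h with
    | t :: ts, h =>
      have := ih ts (by simpa using h)
      simp only [weave, List.headD_cons, List.tail_cons, List.map_cons, List.flatten_cons]
      refine (List.Perm.append_left _ (this.cons k)).trans ?_
      rw [← List.cons_append, ← List.append_assoc, ← List.append_assoc]
      exact List.perm_append_comm.append_right _

theorem graft_replicate_nil (T : BinaryTree α) (m : ℕ) : graft T (List.replicate m .nil) = T := by
  induction T generalizing m with
  | nil => cases m <;> simp [graft, List.replicate_succ]
  | node v l r hl hr => simp [graft, List.take_replicate, List.drop_replicate, hl, hr]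

theorem Reconfigures.inorder_eq {T τ τ' T' : BinaryTree α} (h : Reconfigures T τ τ' T') :
    inorder T' = inorder T := by
  obtain ⟨h1, ts, -, rfl, rfl⟩ := h
  rw [inorder_graft, inorder_graft, h1]

theorem Executes.length_le {T : BinaryTree α} {S : List α} {c : ℕ} (h : Executes T S c) :
    S.length ≤ c := by
  induction h with
  | nil => simp
  | cons _ hx _ ih =>
    have := List.length_pos_of_mem hx
    rw [length_inorder] at this
    simp only [List.length_cons]
    omega

theorem exists_executes (T : BinaryTree α) (S : List α) (hS : ∀ x ∈ S, x ∈ inorder T) :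
    ∃ c, Executes T S c := by
  induction S with
  | nil => exact ⟨0, .nil T⟩
  | cons x S ih =>
    obtain ⟨c, hc⟩ := ih fun y hy => hS y (List.mem_cons_of_mem _ hy)
    refine ⟨_, .cons (τ := T) (τ' := T) (T' := T) ⟨rfl, List.replicate (T.numNodes + 1) .nil, ?_,
      ?_, ?_⟩ (hS x (by simp)) hc⟩
    · simp
    · rw [graft_replicate_nil]
    · rw [graft_replicate_nil]

/-! ### Search paths and the ancestor relation -/

variable [LinearOrder α]

/-- The keys of the tree increase from left to right. -/
def Sorted (T : BinaryTree α) : Prop := (inorder T).Pairwise (· < ·)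

theorem sorted_node {v : α} {l r : BinaryTree α} :
    Sorted (.node v l r) ↔ Sorted l ∧ Sorted r ∧ (∀ a ∈ inorder l, a < v) ∧
      (∀ a ∈ inorder r, v < a) := by
  unfold Sorted
  rw [inorder, List.pairwise_append, List.pairwise_cons]
  constructor
  · rintro ⟨h1, ⟨h2, h3⟩, h4⟩
    exact ⟨h1, h3, fun a ha => h4 a ha v (by simp), h2⟩
  · rintro ⟨h1, h2, h3, h4⟩
    refine ⟨h1, ⟨h4, h2⟩, fun a ha b hb => ?_⟩
    rcases List.mem_cons.mp hb with rfl | hb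
    · exact h3 a ha
    · exact (h3 a ha).trans (h4 b hb)

theorem searchPath_subset {a b : α} {T : BinaryTree α} (h : b ∈ searchPath a T) :
    b ∈ inorder T := by
  induction T with
  | nil => simp [searchPath] at h
  | node v l r hl hr =>
    simp only [searchPath, List.mem_cons] at h
    simp only [inorder, List.mem_append, List.mem_cons]
    split_ifs at h
    · tauto
    · tauto
    · simp at h; tauto

/-- While the searches for `a` and `b` go the same way, the search for a key between them follows,
up to the node `b`. -/
theorem mem_searchPath_of_mem_uIcc {a b c : α} {T : BinaryTree α} (hT : Sorted T)
    (h : b ∈ searchPath a T) (hc : c ∈ Set.uIcc a b) : b ∈ searchPath c T := by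
  induction T with
  | nil => simp [searchPath] at h
  | node v l r hl hr =>
    obtain ⟨h1, h2, h3, h4⟩ := sorted_node.mp hT
    rw [Set.mem_uIcc] at hc
    simp only [searchPath, List.mem_cons] at h ⊢
    rcases h with h | h
    · exact Or.inl h
    right
    split_ifs at h with h5 h6
    · have hb := h3 b (searchPath_subset h)
      have hcv : c < v := by
        rcases hc with hc | hc
        · exact hc.2.trans_lt hb
        · exact hc.2.trans_lt h5
      rw [if_pos hcv]
      exact hl h1 h
    · have hb := h4 b (searchPath_subset h)
      have hcv : v < c := by
        rcases hc with hc | hc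
        · exact h6.trans_le hc.1
        · exact hb.trans_le hc.1
      rw [if_neg hcv.not_gt, if_pos hcv]
      exact hr h2 h
    · simp at h

theorem self_mem_searchPath {a : α} {T : BinaryTree α} (hT : Sorted T) (h : a ∈ inorder T) :
    a ∈ searchPath a T := by
  induction T with
  | nil => simp [inorder] at h
  | node v l r hl hr =>
    obtain ⟨h1, h2, h3, h4⟩ := sorted_node.mp hT
    simp only [inorder, List.mem_append, List.mem_cons] at h
    simp only [searchPath, List.mem_cons]
    rcases h with h | h | h
    · rw [if_pos (h3 a h)]; exact Or.inr (hl h1 h)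
    · exact Or.inl h
    · rw [if_neg (h4 a h).not_gt, if_pos (h4 a h)]; exact Or.inr (hr h2 h)

/-- A key that is on the way from the root to `a` at least as early as all keys between it and `a`
lies on the search path of `a`. -/
theorem mem_searchPath_of_forall_length {a b : α} {T : BinaryTree α} (hT : Sorted T)
    (hb : b ∈ inorder T) (h : ∀ c ∈ inorder T, c ∈ Set.uIcc a b → c ≠ b →
      (searchPath b T).length < (searchPath c T).length) : b ∈ searchPath a T := by
  induction T with
  | nil => simp [inorder] at hb
  | node v l r hl hr =>
    obtain ⟨h1, h2, h3, h4⟩ := sorted_node.mp hT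
    have hv : v ∈ Set.uIcc a b → b = v := by
      intro hv
      by_contra hne
      have := h v (by simp [inorder]) hv (Ne.symm hne)
      simp [searchPath] at this
    simp only [searchPath, List.mem_cons]
    by_cases hbv : b = v
    · exact Or.inl hbv
    right
    have hv' : v ∉ Set.uIcc a b := fun h => hbv (hv h)
    rw [Set.mem_uIcc] at hv'
    push Not at hv'
    simp only [inorder, List.mem_append, List.mem_cons, hbv, false_or] at hb
    rcases hb with hb | hb
    · have hbv := h3 b hb
      have hav : a < v := by
        by_contra! hva
        exact absurd (hv'.2 hbv.le) (by simpa using hva)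
      rw [if_pos hav]
      refine hl h1 hb fun c hc hcu hcb => ?_
      have := h c (by simp [inorder, hc]) hcu hcb
      simpa [searchPath, hbv, h3 c hc] using this
    · have hbv := h4 b hb
      have hav : v < a := by
        by_contra! hva
        exact absurd (hv'.1 hva) (by simpa using hbv.le)
      rw [if_neg hav.not_gt, if_pos hav]
      refine hr h2 hb fun c hc hcu hcb => ?_
      have := h c (by simp [inorder, hc]) hcu hcb
      simpa [searchPath, hbv, hbv.not_gt, h4 c hc, (h4 c hc).not_gt] using this

theorem length_searchPath_lt {b c : α} {T : BinaryTree α} (hT : Sorted T)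
    (h : b ∈ searchPath c T) (hc : c ∈ inorder T) (hbc : c ≠ b) :
    (searchPath b T).length < (searchPath c T).length := by
  induction T with
  | nil => simp [inorder] at hc
  | node v l r hl hr =>
    obtain ⟨h1, h2, h3, h4⟩ := sorted_node.mp hT
    simp only [searchPath, List.mem_cons] at h
    simp only [inorder, List.mem_append, List.mem_cons] at hc
    rcases h with rfl | h
    · rcases hc with hc | hc | hc
      · have := List.length_pos_of_mem (self_mem_searchPath h1 hc)
        simpa [searchPath, h3 c hc] using this
      · exact absurd hc hbc
      · have := List.length_pos_of_mem (self_mem_searchPath h2 hc)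
        simpa [searchPath, h4 c hc, (h4 c hc).not_gt] using this
    · split_ifs at h with h5 h6
      · have hb := h3 b (searchPath_subset h)
        have hcl : c ∈ inorder l := by
          rcases hc with hc | hc | hc
          · exact hc
          · exact absurd hc h5.ne
          · exact absurd (h4 c hc) h5.not_gt
        simpa [searchPath, hb, h5] using hl h1 h hcl
      · have hb := h4 b (searchPath_subset h)
        have hcr : c ∈ inorder r := by
          rcases hc with hc | hc | hc
          · exact absurd (h3 c hc) h5
          · exact absurd hc h6.ne'
          · exact hc
        simpa [searchPath, hb, h6, hb.not_gt, h6.not_gt] using hr h2 h hcr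
      · simp at h

theorem mem_searchPath_of_isolated {a b : α} {T : BinaryTree α} (hT : Sorted T)
    (hb : b ∈ inorder T) (h : ∀ c ∈ inorder T, c ∈ Set.uIcc a b → c = b) : b ∈ searchPath a T :=
  mem_searchPath_of_forall_length hT hb fun c hc hcu hcb => absurd (h c hc hcu) hcb

theorem length_searchPath_le (a : α) (T : BinaryTree α) :
    (searchPath a T).length ≤ T.numNodes := by
  induction T with
  | nil => simp [searchPath]
  | node v l r hl hr =>
    simp only [searchPath, List.length_cons, BinaryTree.numNodes]
    split_ifs
    · omega
    · omega
    · simp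

/-- The hanging tree in which the search continues depends only on the key list of `τ`, not on its
shape, so it is the same one after a rearrangement. -/
theorem searchPath_graft {τ : BinaryTree α} (hτ : Sorted τ) (a : α) {ts : List (BinaryTree α)}
    (hts : ts.length = τ.numNodes + 1) :
    searchPath a (graft τ ts) = searchPath a τ ++
      if a ∈ inorder τ then [] else
        searchPath a (ts.getD ((inorder τ).countP (· < a)) .nil) := by
  induction τ generalizing ts with
  | nil => cases ts <;> simp [graft, inorder, searchPath]
  | node v l r hl hr =>
    obtain ⟨h1, h2, h3, h4⟩ := sorted_node.mp hτ
    simp only [BinaryTree.numNodes] at hts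
    have hcl : ∀ b, (inorder l).countP (· < b) ≤ l.numNodes := fun b => by
      rw [← length_inorder]; exact List.countP_le_length
    rcases lt_trichotomy a v with hav | rfl | hav
    · have har : a ∉ inorder r := fun h => (h4 a h).not_gt hav
      have hc : (inorder r).countP (· < a) = 0 := by
        rw [List.countP_eq_zero]
        intro b hb
        simpa using (hav.trans (h4 b hb)).le
      have h5 := hcl a
      simp only [graft, searchPath, hav, if_true, inorder, List.mem_append, List.mem_cons, har,
        hav.ne, or_false, List.cons_append, List.countP_append, List.countP_cons, hc, hav.not_gt,
        decide_false]
      rw [hl h1 (by simp; omega)]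
      congr 3
      simp [List.getD_eq_getElem?_getD, Nat.lt_succ_of_le h5]
    · simp [graft, searchPath, inorder]
    · have hal : a ∉ inorder l := fun h => (h3 a h).not_gt hav
      have hc : (inorder l).countP (· < a) = l.numNodes := by
        rw [← length_inorder, List.countP_eq_length]
        intro b hb
        simpa using (h3 b hb).trans hav
      simp only [graft, searchPath, hav, hav.not_gt, if_true, if_false, inorder, List.mem_append,
        List.mem_cons, hal, hav.ne', false_or, List.cons_append, List.countP_append,
        List.countP_cons, hc, decide_true]
      rw [hr h2 (by simp; omega)]
      congr 3
      simp [List.getD_eq_getElem?_getD, List.getElem?_drop, Nat.add_comm, Nat.add_assoc]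

/-- The search path of a key is a connected part of the tree that contains the root. -/
theorem exists_graft_searchPath (x : α) (T : BinaryTree α) :
    ∃ τ ts, ts.length = τ.numNodes + 1 ∧ T = graft τ ts ∧
      ∀ k, k ∈ inorder τ ↔ k ∈ searchPath x T := by
  induction T with
  | nil => exact ⟨.nil, [.nil], by simp, by simp [graft], by simp [inorder, searchPath]⟩
  | node v l r hl hr =>
    rcases lt_trichotomy x v with h | rfl | h
    · obtain ⟨τ, ts, h1, h2, h3⟩ := hl
      refine ⟨.node v τ .nil, ts ++ [r], by simp [h1], ?_, fun k => ?_⟩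
      · rw [graft, ← h1, List.take_left, List.drop_left, ← h2]
        simp [graft]
      · simp [inorder, searchPath, h, h3, or_comm]
    · exact ⟨.node x .nil .nil, [l, r], by simp, by simp [graft], by simp [inorder, searchPath]⟩
    · obtain ⟨τ, ts, h1, h2, h3⟩ := hr
      refine ⟨.node v .nil τ, l :: ts, by simp [h1], ?_, fun k => ?_⟩
      · simp [graft, ← h2]
      · simp [inorder, searchPath, h, h.not_gt, h3]

/-- Every increasing list of keys can be arranged by the rule of `GreedyFuture`. -/
theorem exists_futureArranged (K : List α) (hK : K.Pairwise (· < ·)) (F : List α) :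
    ∃ τ, inorder τ = K ∧ FutureArranged F τ := by
  induction hn : K.length using Nat.strong_induction_on generalizing K F with
  | _ n ih =>
    subst hn
    by_cases hne : K = []
    · exact ⟨.nil, by simp [inorder, hne], trivial⟩
    have hroot : ∃ v ∈ K, ∀ x ∈ F.head?, ∀ k ∈ K, k ∈ Set.uIcc v x → k = v := by
      have hKf : K.toFinset.Nonempty := by simpa [List.toFinset_nonempty_iff] using hne
      cases F with
      | nil => exact ⟨K.head hne, List.head_mem hne, by simp⟩
      | cons x F =>
        simp only [List.head?_cons, Option.mem_def, Option.some.injEq, forall_eq']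
        -- The root is the largest key `≤ x`, which is `x` itself if present, and the smallest key
        -- if all exceed `x`.
        by_cases hx : (K.toFinset.filter (· ≤ x)).Nonempty
        · have hm := Finset.max'_mem _ hx
          simp only [Finset.mem_filter, List.mem_toFinset] at hm
          refine ⟨_, hm.1, fun k hk hku => ?_⟩
          rw [Set.uIcc_of_le hm.2] at hku
          refine le_antisymm (Finset.le_max' _ _ ?_) hku.1
          simp [hk, hku.2]
        · have hm := Finset.min'_mem _ hKf
          have hlt : ∀ k ∈ K, x < k := by
            intro k hk
            by_contra! h
            exact hx ⟨k, by simp [hk, h]⟩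
          rw [List.mem_toFinset] at hm
          refine ⟨_, hm, fun k hk hku => ?_⟩
          rw [Set.uIcc_of_ge (hlt _ hm).le] at hku
          exact le_antisymm hku.2 (Finset.min'_le _ _ (by simpa using hk))
    obtain ⟨v, hv, hF⟩ := hroot
    obtain ⟨K₁, K₂, rfl⟩ := List.append_of_mem hv
    have hK1 := hK.sublist (List.sublist_append_left K₁ (v :: K₂))
    have hK2 := (hK.sublist (List.sublist_append_right K₁ (v :: K₂))).of_cons
    obtain ⟨l, hl1, hl2⟩ := ih K₁.length (by simp) K₁ hK1 (F.filter (· < v)) rfl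
    obtain ⟨r, hr1, hr2⟩ := ih K₂.length (by simp; omega) K₂ hK2 (F.filter (v < ·)) rfl
    refine ⟨.node v l r, by simp [inorder, hl1, hr1], ?_, hl2, hr2⟩
    simpa [inorder, hl1, hr1] using hF

theorem exists_greedyFutureRun (S : List α) (T : BinaryTree α) (hT : Sorted T) :
    ∃ m, GreedyFutureRun T S m := by
  induction S generalizing T with
  | nil => exact ⟨0, .nil T⟩
  | cons x S ih =>
    obtain ⟨τ, ts, h1, h2, h3⟩ := exists_graft_searchPath x T
    have hτ : Sorted τ := by
      have := hT
      unfold Sorted at this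
      rw [h2, inorder_graft] at this
      exact this.sublist (sublist_weave _ _)
    obtain ⟨τ', h4, h5⟩ := exists_futureArranged (inorder τ) hτ S
    have hrec : Reconfigures T τ τ' (graft τ' ts) := ⟨h4.symm, ts, h1, h2, rfl⟩
    have hT' : Sorted (graft τ' ts) := by
      unfold Sorted; rw [hrec.inorder_eq]; exact hT
    obtain ⟨m, hm⟩ := ih _ hT'
    exact ⟨_, .cons hrec h3 h5 hm⟩

/-- In a tree arranged by the rule of `GreedyFuture`, the first future request whose search path
contains `b` has `b` as its neighbour. -/
theorem FutureArranged.eq_of_mem_uIcc {F : List α} {τ : BinaryTree α} (h : FutureArranged F τ)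
    (hτ : Sorted τ) {b y : α} {F₁ F₂ : List α} (hF : F = F₁ ++ y :: F₂)
    (h₁ : ∀ z ∈ F₁, b ∉ searchPath z τ) (hy : b ∈ searchPath y τ) {c : α} (hc : c ∈ inorder τ)
    (hcu : c ∈ Set.uIcc b y) : c = b := by
  induction τ generalizing F F₁ F₂ with
  | nil => simp [inorder] at hc
  | node v l r hl hr =>
    obtain ⟨t1, t2, t3, t4⟩ := sorted_node.mp hτ
    obtain ⟨f1, f2, f3⟩ := h
    by_cases hbv : b = v
    · subst hbv
      -- Every search passes through the root, so `y` is the very next request and the root rule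
      -- applies to it.
      have : F₁ = [] := by
        rw [List.eq_nil_iff_forall_not_mem]
        exact fun z hz => h₁ z hz (by simp [searchPath])
      exact f1 y (by simp [hF, this]) c hc hcu
    · simp only [searchPath, List.mem_cons, hbv, false_or] at hy
      rw [Set.mem_uIcc] at hcu
      split_ifs at hy with h5 h6
      · have hb := t3 b (searchPath_subset hy)
        have hcv : c < v := by
          rcases hcu with h | h
          · exact h.2.trans_lt h5
          · exact h.2.trans_lt hb
        have hcl : c ∈ inorder l := by
          simp only [inorder, List.mem_append, List.mem_cons] at hc
          rcases hc with hc | hc | hc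
          · exact hc
          · exact absurd hc hcv.ne
          · exact absurd (t4 c hc) hcv.not_gt
        refine hl f2 t1 (F₁ := F₁.filter (· < v)) (F₂ := F₂.filter (· < v))
          (by simp [hF, h5]) ?_ hy hcl
        intro z hz
        simp only [List.mem_filter, decide_eq_true_eq] at hz
        have := h₁ z hz.1
        simpa [searchPath, hz.2, hbv] using this
      · have hb := t4 b (searchPath_subset hy)
        have hcv : v < c := by
          rcases hcu with h | h
          · exact hb.trans_le h.1
          · exact h6.trans_le h.1
        have hcr : c ∈ inorder r := by
          simp only [inorder, List.mem_append, List.mem_cons] at hc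
          rcases hc with hc | hc | hc
          · exact absurd (t3 c hc) hcv.not_gt
          · exact absurd hc hcv.ne'
          · exact hc
        refine hr f3 t2 (F₁ := F₁.filter (v < ·)) (F₂ := F₂.filter (v < ·))
          (by simp [hF, h6]) ?_ hy hcr
        intro z hz
        simp only [List.mem_filter, decide_eq_true_eq] at hz
        have := h₁ z hz.1
        simpa [searchPath, hz.2, hz.2.not_gt, hbv] using this
      · simp at hy

/-! ### The cost of GreedyFuture -/

/-- The last touch times `f` describe the ancestors in the tree `T`, as far as they matter to the
future requests `F`. -/
structure Consistent (T : BinaryTree α) (F : List α) (f : α → ℕ) : Prop where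
  mem_searchPath : ∀ a b, (∀ c ∈ Set.uIcc a b, c ≠ b → f c < f b) → b ∈ searchPath a T
  lt_of_first : ∀ b y F₁ F₂, F = F₁ ++ y :: F₂ → (∀ z ∈ F₁, b ∉ searchPath z T) →
    b ∈ searchPath y T → ∀ c ∈ Set.uIcc b y, c ≠ b → f c < f b

/-- The initial tree is turned into fictitious past times: shallower keys count as touched later,
and ancestors then beat their descendants strictly. -/
theorem consistent_depth {T : BinaryTree α} (hT : Sorted T) (hall : ∀ a, a ∈ inorder T)
    (F : List α) : Consistent T F fun a => T.numNodes - (searchPath a T).length := by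
  constructor
  · intro a b h
    refine mem_searchPath_of_forall_length hT (hall b) fun c _ hcu hcb => ?_
    have := h c hcu hcb
    omega
  · intro b y F₁ F₂ _ _ hy c hcu hcb
    have h1 := mem_searchPath_of_mem_uIcc hT hy (Set.uIcc_comm b y ▸ hcu)
    have h2 := length_searchPath_lt hT h1 (hall c) hcb
    have h3 := length_searchPath_le c T
    show _ - _ < _ - _
    omega

variable [Fintype α]

theorem Consistent.mem_touched_iff {T : BinaryTree α} {x : α} {S : List α} {f : α → ℕ}
    (h : Consistent T (x :: S) f) (b : α) : b ∈ touched f x ↔ b ∈ searchPath x T := by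
  rw [mem_touched]
  constructor
  · intro hb
    exact h.mem_searchPath x b (Set.uIcc_comm b x ▸ hb)
  · intro hb
    exact h.lt_of_first b x [] S rfl (by simp) hb

/-- Ancestors outside the touched part keep their descendants, and those inside are decided by `τ'`
alone. Two touched keys tie at time `m`, so for a touched `b` both implications reduce to having no
other touched key in between; this makes `b` an ancestor, and the arrangement rule provides it for
the first request through `b`. -/
theorem Consistent.step {T τ τ' T' : BinaryTree α} {x : α} {S : List α} {f : α → ℕ} {m : ℕ}
    (h : Consistent T (x :: S) f) (hT : Sorted T) (hrec : Reconfigures T τ τ' T')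
    (hτ : ∀ k, k ∈ inorder τ ↔ k ∈ searchPath x T) (harr : FutureArranged S τ')
    (hf : ∀ b, f b < m) : Consistent T' S (touch f x m) := by
  have hT' : Sorted T' := by unfold Sorted; rw [hrec.inorder_eq]; exact hT
  obtain ⟨hττ, ts, hlen, rfl, rfl⟩ := hrec
  have hsτ : Sorted τ := by
    unfold Sorted at hT ⊢
    rw [inorder_graft] at hT
    exact hT.sublist (sublist_weave _ _)
  have hsτ' : Sorted τ' := by unfold Sorted; rw [← hττ]; exact hsτ
  have hlen' : ts.length = τ'.numNodes + 1 := by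
    rw [hlen, ← length_inorder, ← length_inorder, hττ]
  have hmem : ∀ b, b ∈ touched f x ↔ b ∈ inorder τ := fun b => by rw [h.mem_touched_iff, hτ]
  have hold : ∀ a b, b ∉ inorder τ → b ∈ searchPath a (graft τ ts) → a ∉ inorder τ := by
    intro a b hb hab ha
    rw [searchPath_graft hsτ a hlen, if_pos ha, List.append_nil] at hab
    exact hb (searchPath_subset hab)
  have hiff : ∀ a b, b ∉ inorder τ →
      (b ∈ searchPath a (graft τ ts) ↔ b ∈ searchPath a (graft τ' ts)) := by
    intro a b hb
    have h1 : b ∉ searchPath a τ := fun h => hb (searchPath_subset h)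
    have h2 : b ∉ searchPath a τ' := fun h => hb (hττ ▸ searchPath_subset h)
    rw [searchPath_graft hsτ a hlen, searchPath_graft hsτ' a hlen', List.mem_append,
      List.mem_append, hττ]
    simp only [h1, h2, false_or]
  have hnew : ∀ a b, b ∈ inorder τ →
      (b ∈ searchPath a (graft τ' ts) ↔ b ∈ searchPath a τ') := by
    intro a b hb
    rw [searchPath_graft hsτ' a hlen', List.mem_append, or_iff_left]
    split_ifs with ha
    · simp
    · intro hbt
      have hb2 := searchPath_subset hbt
      have hnd : (weave (inorder τ') ts).Nodup := by
        rw [← inorder_graft]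
        exact hT'.imp fun h => h.ne
      rw [(weave_perm (inorder τ') ts (by rw [hlen', length_inorder])).nodup_iff,
        List.nodup_append] at hnd
      set i := (inorder τ').countP (· < a)
      by_cases hi : i < ts.length
      · rw [List.getD_eq_getElem _ _ hi] at hb2
        refine hnd.2.2 b (hττ ▸ hb) b ?_ rfl
        exact List.mem_flatten.mpr ⟨_, List.mem_map_of_mem (List.getElem_mem hi), hb2⟩
      · rw [List.getD_eq_default _ _ (by omega)] at hb2
        simp [inorder] at hb2
  constructor
  · intro a b hab
    by_cases hb : b ∈ inorder τ
    · rw [hnew a b hb]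
      refine mem_searchPath_of_isolated hsτ' (hττ ▸ hb) fun c hc hcu => ?_
      by_contra hcb
      have := hab c hcu hcb
      rw [touch_of_mem m ((hmem b).mpr hb), touch_of_mem m ((hmem c).mpr (hττ ▸ hc))] at this
      omega
    · rw [← hiff a b hb]
      refine h.mem_searchPath a b fun c hcu hcb => ?_
      have := hab c hcu hcb
      have hfb := hf b
      rw [touch_of_not_mem m (fun h => hb ((hmem b).mp h))] at this
      by_cases hc : c ∈ touched f x
      · rw [touch_of_mem m hc] at this; omega
      · rwa [touch_of_not_mem m hc] at this
  · intro b y F₁ F₂ hF h₁ hy c hcu hcb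
    by_cases hb : b ∈ inorder τ
    · rw [touch_of_mem m ((hmem b).mpr hb)]
      have hc : c ∉ touched f x := by
        intro hc
        refine hcb (harr.eq_of_mem_uIcc hsτ' hF (fun z hz => ?_) ((hnew y b hb).mp hy)
          (hττ ▸ (hmem c).mp hc) hcu)
        rw [← hnew z b hb]
        exact h₁ z hz
      rw [touch_of_not_mem m hc]
      exact hf c
    -- All keys between `b` and `y` have `b` as an ancestor, so they are untouched too. The path of
    -- `x` avoids `b`, so `y` is still the first request through `b` when `x` is put in front.
    · have hy' := (hiff y b hb).mpr hy
      have hbc := mem_searchPath_of_mem_uIcc hT hy' (Set.uIcc_comm b y ▸ hcu)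
      rw [touch_of_not_mem m (fun h => hb ((hmem b).mp h)),
        touch_of_not_mem m (fun h => hold c b hb hbc ((hmem c).mp h))]
      refine h.lt_of_first b y (x :: F₁) F₂ (by rw [hF]; rfl) ?_ hy' c hcu hcb
      intro z hz
      rcases List.mem_cons.mp hz with rfl | hz
      · rwa [← hτ]
      · rw [hiff z b hb]
        exact h₁ z hz

theorem GreedyFutureRun.cost_eq {T : BinaryTree α} {S : List α} {c : ℕ}
    (h : GreedyFutureRun T S c) (hT : Sorted T) {f : α → ℕ} {m : ℕ} (hf : ∀ b, f b < m)
    (hc : Consistent T S f) : c = touchCount Finset.univ Finset.univ f m S := by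
  classical
  induction h generalizing f m with
  | nil => rfl
  | @cons T τ τ' T' x S c hrec hτ harr _ ih =>
    have hT' : Sorted T' := by unfold Sorted; rw [hrec.inorder_eq]; exact hT
    have hsτ : Sorted τ := by
      obtain ⟨-, ts, -, rfl, -⟩ := hrec
      unfold Sorted at hT ⊢
      rw [inorder_graft] at hT
      exact hT.sublist (sublist_weave _ _)
    have hS : touched f x = (inorder τ).toFinset := by
      ext b
      rw [hc.mem_touched_iff, List.mem_toFinset, hτ]
    have hcard : (touched f x).card = τ.numNodes := by
      rw [hS, List.toFinset_card_of_nodup (hsτ.imp fun h => h.ne), length_inorder]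
    simp only [touchCount, Finset.mem_univ, if_true, Finset.inter_univ]
    rw [hcard, ← ih hT' (touch_lt hf x) (hc.step hT hrec hτ harr hf)]

end Tree

theorem IsSearchTree.sorted {n : ℕ} {T : BinaryTree (Fin n)} (h : IsSearchTree T) : Sorted T := by
  unfold Sorted
  rw [h]
  exact List.pairwise_lt_finRange n

theorem IsSearchTree.mem {n : ℕ} {T : BinaryTree (Fin n)} (h : IsSearchTree T) (k : Fin n) :
    k ∈ inorder T := by
  rw [h]
  exact List.mem_finRange k

theorem GreedyFutureRun.cost_le {n : ℕ} {σ : Equiv.Perm (Fin n)} {T : BinaryTree (Fin n)}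
    (hT : IsSearchTree T) {m : ℕ} (h : GreedyFutureRun T (requests σ) m) :
    m ≤ n * (5 * Nat.clog 2 n + 1) := by
  have hf : ∀ b, T.numNodes - (searchPath b T).length < T.numNodes + 1 := fun b => by omega
  rw [h.cost_eq hT.sorted hf (consistent_depth hT.sorted hT.mem _)]
  exact touchCount_univ_le (nodup_requests σ) hf

theorem le_optBST {n : ℕ} (σ : Equiv.Perm (Fin n)) {T : BinaryTree (Fin n)}
    (hT : IsSearchTree T) : n ≤ optBST σ := by
  obtain ⟨c, hc⟩ := exists_executes T (requests σ) fun x _ => hT.mem x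
  refine le_csInf ⟨c, T, hT, hc⟩ ?_
  rintro c ⟨T, -, hc⟩
  simpa [requests] using hc.length_le

end GreedyBST
-- Constants and the final assembly
theorem GreedyBST.mul_clog_le_mul_log {n : ℕ} (hn : 2 ≤ n) :
    ((n * (5 * Nat.clog 2 n + 1) : ℕ) : ℝ) ≤ 16 * (n * Real.log n) := by
  have hlog2 := Real.log_two_gt_d9
  have hpos : 0 < Nat.clog 2 n := Nat.clog_pos one_lt_two hn
  have h1 : 2 ^ (Nat.clog 2 n - 1) < n := Nat.pow_pred_clog_lt_self one_lt_two hn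
  have h2 : ((Nat.clog 2 n : ℝ) - 1) * Real.log 2 ≤ Real.log n := by
    have h3 : ((2 : ℝ) ^ (Nat.clog 2 n - 1)) ≤ n := by exact_mod_cast h1.le
    have h4 := Real.log_le_log (by positivity) h3
    rwa [Real.log_pow, Nat.cast_sub hpos, Nat.cast_one] at h4
  have h5 : Real.log 2 ≤ Real.log n :=
    Real.log_le_log two_pos (by exact_mod_cast hn)
  -- Write the left side as `5 (clog - 1) + 6`; it is at most `(11 / log 2) log n`, and `11 / log 2
  -- < 16`.
  have h6 : (5 * Nat.clog 2 n + 1 : ℝ) ≤ 16 * Real.log n := by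
    nlinarith
  push_cast
  have := mul_le_mul_of_nonneg_left h6 (Nat.cast_nonneg (α := ℝ) n)
  linarith

theorem theorem1 :
    ∃ C c : ℝ, 0 < C ∧ 0 < c ∧ ∀ n : ℕ, 2 ≤ n → ∀ σ : Equiv.Perm (Fin n),
      -- GreedyArb outputs an arborally satisfied superset of the input
      GreedyBST.ArborallySatisfied
          ((GreedyBST.inputSet σ : Set (ℝ × ℝ)) ∪ (GreedyBST.greedyAdded σ : Set (ℝ × ℝ))) ∧
      -- it adds at most `C n log n` points
      ((GreedyBST.greedyAdded σ).card : ℝ) ≤ C * (n * Real.log n) ∧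
      -- the optimum is at least linear
      c * n ≤ (GreedyBST.minArb (GreedyBST.inputSet σ) : ℝ) ∧
      -- GreedyArb is `O(log n)`-competitive
      ((GreedyBST.greedyAdded σ).card : ℝ) ≤
          C * Real.log n * (GreedyBST.minArb (GreedyBST.inputSet σ) : ℝ) ∧
      -- GreedyFuture, from any initial tree, is `O(log n)`-competitive
      ∀ T : BinaryTree (Fin n), GreedyBST.IsSearchTree T →
        (∃ m : ℕ, GreedyBST.GreedyFutureRun T (GreedyBST.requests σ) m) ∧
        ∀ m : ℕ, GreedyBST.GreedyFutureRun T (GreedyBST.requests σ) m →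
          (m : ℝ) ≤ C * Real.log n * (GreedyBST.optBST σ : ℝ) := by
  -- For `n ≥ 2` one has `n ≤ 3 ⌊n/2⌋`, with equality at `n = 3`; this gives `1/3`, and `48 = 3 ·
  -- 16`.
  refine ⟨48, 1 / 3, by norm_num, by norm_num, fun n hn σ => ?_⟩
  have hlog : 0 ≤ Real.log n := Real.log_natCast_nonneg n
  have hnlog : 0 ≤ n * Real.log n := mul_nonneg (Nat.cast_nonneg n) hlog
  have hbound := GreedyBST.mul_clog_le_mul_log hn
  have hadded : ((GreedyBST.greedyAdded σ).card : ℝ) ≤ 16 * (n * Real.log n) :=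
    le_trans (by exact_mod_cast GreedyBST.card_greedyAdded_le σ) hbound
  have hmin : (1 / 3 : ℝ) * n ≤ GreedyBST.minArb (GreedyBST.inputSet σ) := by
    have h1 := GreedyBST.half_le_minArb σ
    have h2 : n ≤ 3 * GreedyBST.minArb (GreedyBST.inputSet σ) := by omega
    have h3 : (n : ℝ) ≤ 3 * GreedyBST.minArb (GreedyBST.inputSet σ) := by exact_mod_cast h2
    linarith
  refine ⟨?_, by linarith, hmin, ?_, fun T hT => ⟨?_, fun m hm => ?_⟩⟩
  · rw [GreedyBST.coe_inputSet_union_greedyAdded]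
    exact GreedyBST.arborallySatisfied_greedyArb (GreedyBST.pairwise_inputList σ)
  · have := mul_le_mul_of_nonneg_left hmin hlog
    linarith
  · exact GreedyBST.exists_greedyFutureRun _ T hT.sorted
  · have h1 : (m : ℝ) ≤ 16 * (n * Real.log n) :=
      le_trans (by exact_mod_cast hm.cost_le hT) hbound
    have h2 : (n : ℝ) ≤ GreedyBST.optBST σ := by exact_mod_cast GreedyBST.le_optBST σ hT
    have := mul_le_mul_of_nonneg_left h2 hlog
    linarith
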